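/- Let $\mathcal V$ be a set of atoms. A c-atom is a pair $A=(A_d,A_c)$ with $A_d\subseteq\mathcal V$ finite and $A_c\subseteq 2^{A_d}$; a set $I\subseteq\mathcal V$ (an interpretation) satisfies $A$, written $I\models A$, if $I\cap A_d\in A_c$. A basic program $P$ is a finite set of rules $r$ of the form $a\leftarrow A_1,\dots,A_n$ ($n\ge 0$) with an atom $a=\mathrm{head}(r)$ and c-atoms $A_i$ (a rule $\bot\leftarrow A_1,\dots,A_n$ is read as $f\leftarrow A_1,\dots,A_n,(\{f\},\{\emptyset\})$ with a new atom $f$). $I$ satisfies the body of $r$ if $I\models A_i$ for all $i$; $I$ is a model of $P$ if $\mathrm{head}(r)\in I$ for every $r\in P$ whose body $I$ satisfies; a model $I$ is supported if every $a\in I$ is the head of a rule of $P$ whose body $I$ satisfies. *Abstract representation.* A prefixed power set $W\uplus V$ covers $S$ if $W\subseteq S\subseteq W\cup V$; it is included in $W'\uplus V'$ if every set it covers is covered by $W'\uplus V'$. For a c-atom $A$, $W\in A_c$ and $V\subseteq A_d\setminus W$, $W\uplus V$ is $W$-maximal in $A$ if all sets it covers are in $A_c$ and there is no $V'$ with $V\subsetneq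 V'\subseteq A_d\setminus W$ such that all sets covered by $W\uplus V'$ are in $A_c$. $A_c^*$ is the collection of all $W\uplus V$ that are $W$-maximal in $A$, for $W\in A_c$, with those included in another member of this collection removed. *Stable models.* For an interpretation $I$, a set $W$ is a satisfiable set of $A$ with respect to $I\cap A_d$ if some $W\uplus V\in A_c^*$ covers $I\cap A_d$. The generalized Gelfond–Lifschitz transformation $P^I$ is obtained from $P$ by removing all rules whose body is not satisfied by $I$, replacing each c-atom $A$ in the bodies of the remaining rules by a new special atom $\theta_A$, and adding, for each such $A$ and each satisfiable set $W$ of $A$ with respect to $I\cap A_d$, the rule $\theta_A\leftarrow W$. $I$ is a stable model of $P$ if $I$ is obtained from a minimal model of $P^I$ by deleting the special atoms $\theta_A$. *Dependency graph.* $G_P$ has as vertices the atoms of $P$. There is a positive edge $u\to^+v$ if there are a rule of $P$ with head $u$, a c-atom $A$ in its body and $W\uplus V\in A_c^*$ with $v\in W$; there is a negative edge $u\to^-v$ if instead $v\in A_d\setminus(W\cup V)$. (Both edges may be present.) A cycle is a closed path through distinct atoms along edges of $G_P$, self-loops included; it is positive if all its edges are positive, odd if it has an odd number of negative edges, and even (an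 even loop) if it has an even number of negative edges. $P$ is call-consistent if $G_P$ has no odd cycle, and acyclic if $G_P$ has no cycle of any kind. **Theorem.** Let $P$ be a basic program. 1. If $P$ is call-consistent, then $P$ has a stable model. 2. If $P$ has more than one stable model, then $P$ has an even loop. 3. If $P$ is acyclic, then $P$ has a unique stable model. 4. If $P$ has no positive cycle, then every supported model of $P$ is a stable model of $P$. -/

import Mathlib

/-- An abstract constraint atom (c-atom) `A = (A_d, A_c)`: a finite set `dom = A_d` of atoms and a
collection `sols = A_c` of subsets of it. -/
structure CAtom (α : Type*) where
  dom : Finset α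
  sols : Set (Set α)
  sols_subset : ∀ S ∈ sols, S ⊆ (dom : Set α)

/-- `I` satisfies the c-atom `A` if `I ∩ A_d ∈ A_c`. -/
def CAtom.Sat {α : Type*} (I : Set α) (A : CAtom α) : Prop :=
  I ∩ (A.dom : Set α) ∈ A.sols

/-- The pair denoting the prefixed power set `W ⊎ V`, with `pre = W` and `free = V`. -/
@[ext]
structure PrefixedPowerSet (α : Type*) where
  pre : Set α
  free : Set α

/-- `W ⊎ V` covers `S` if `W ⊆ S ⊆ W ∪ V`. -/
def PrefixedPowerSet.Covers {α : Type*} (p : PrefixedPowerSet α) (S : Set α) : Prop :=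
  p.pre ⊆ S ∧ S ⊆ p.pre ∪ p.free

/-- `p` is included in `q` if every set covered by `p` is covered by `q`. -/
def PrefixedPowerSet.IncludedIn {α : Type*} (p q : PrefixedPowerSet α) : Prop :=
  ∀ S : Set α, p.Covers S → q.Covers S

/-- `W ⊎ V` is `W`-maximal in `A`, where `W ∈ A_c` and `V ⊆ A_d \ W`: all sets it covers are in
`A_c`, and this fails for every `V'` with `V ⊂ V' ⊆ A_d \ W`. -/
def CAtom.IsMaximalIn {α : Type*} (A : CAtom α) (p : PrefixedPowerSet α) : Prop :=
  p.pre ∈ A.sols ∧ p.free ⊆ (A.dom : Set α) \ p.pre ∧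
    (∀ S : Set α, p.Covers S → S ∈ A.sols) ∧
    ¬ ∃ V' : Set α, p.free ⊂ V' ∧ V' ⊆ (A.dom : Set α) \ p.pre ∧
      ∀ S : Set α, (PrefixedPowerSet.mk p.pre V').Covers S → S ∈ A.sols

/-- The collection `A_c^*` of the abstract representation `(A_d, A_c^*)` of `A`: all abstract
`S`-prefixed power sets of `A`, for `S ∈ A_c`, except the redundant ones, that is, those included
in another one. -/
def CAtom.absRep {α : Type*} (A : CAtom α) : Set (PrefixedPowerSet α) :=
  {p | A.IsMaximalIn p ∧ ¬ ∃ q, A.IsMaximalIn q ∧ q ≠ p ∧ p.IncludedIn q}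

/-- `W` is a satisfiable set of `A` with respect to `I ∩ A_d`. -/
def CAtom.IsSatisfiableSet {α : Type*} (A : CAtom α) (I W : Set α) : Prop :=
  ∃ p ∈ A.absRep, p.Covers (I ∩ (A.dom : Set α)) ∧ p.pre = W

/-- A basic rule `a ← A₁, …, Aₙ`, whose head is (the elementary c-atom of) an atom `a` and whose
body is a finite set of c-atoms. -/
structure BasicRule (α : Type*) where
  head : α
  body : Finset (CAtom α)

/-- The c-atom `({f}, {∅})`, the complement of the elementary c-atom `({f}, {{f}})`. -/
def CAtom.notAtom {α : Type*} (f : α) : CAtom α where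
  dom := {f}
  sols := {∅}
  sols_subset := by
    intro S hS
    rw [Set.mem_singleton_iff.mp hS]
    exact Set.empty_subset _

open Classical in
/-- The basic rule `f ← body, ({f}, {∅})` that a rule `⊥ ← body` stands for, `f` being an atom
reserved for this purpose. -/
noncomputable def BasicRule.ofConstraint {α : Type*} (f : α) (body : Finset (CAtom α)) :
    BasicRule α where
  head := f
  body := insert (CAtom.notAtom f) body

/-- A basic program is a finite set of basic rules. -/
abbrev BasicProgram (α : Type*) := Finset (BasicRule α)

/-- `I` satisfies the body of `r`. -/
def BasicRule.BodySat {α : Type*} (I : Set α) (r : BasicRule α) : Prop :=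
  ∀ A ∈ r.body, A.Sat I

namespace BasicProgram

/-- `I` is a model of `P`. -/
def IsModel {α : Type*} (P : BasicProgram α) (I : Set α) : Prop :=
  ∀ r ∈ P, r.BodySat I → r.head ∈ I

/-- `I` is a supported model of `P`. -/
def IsSupportedModel {α : Type*} (P : BasicProgram α) (I : Set α) : Prop :=
  P.IsModel I ∧ ∀ a ∈ I, ∃ r ∈ P, r.head = a ∧ r.BodySat I

end BasicProgram

/-- The atoms of the transformed program: the original atoms and a special atom `θ_A` for every
c-atom `A`. -/
inductive ExtAtom (α : Type*) where
  | ord (a : α)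
  | theta (A : CAtom α)

/-- A rule `head ← body` with ordinary atoms and without negation. -/
structure PositiveRule (β : Type*) where
  head : β
  body : Set β

/-- `M` is a model of the set `Q` of positive rules. -/
def PositiveRule.IsModel {β : Type*} (Q : Set (PositiveRule β)) (M : Set β) : Prop :=
  ∀ r ∈ Q, r.body ⊆ M → r.head ∈ M

namespace BasicProgram

/-- The generalized Gelfond-Lifschitz transformation `P^I` of a basic program: rules whose body
is not satisfied by `I` are removed; in each remaining rule every c-atom `A` of the body is replaced
by `θ_A`, and a rule `θ_A ← W` is introduced for every satisfiable set `W` of `A` with respect to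
`I ∩ A_d`. -/
def reduct {α : Type*} (P : BasicProgram α) (I : Set α) : Set (PositiveRule (ExtAtom α)) :=
  {q | ∃ r ∈ P, r.BodySat I ∧
    (q = ⟨ExtAtom.ord r.head, {x | ∃ A ∈ r.body, x = ExtAtom.theta A}⟩ ∨
      ∃ A ∈ r.body, ∃ W : Set α, A.IsSatisfiableSet I W ∧
        q = ⟨ExtAtom.theta A, ExtAtom.ord '' W⟩)}

/-- `I` is a stable model of `P` if it is a minimal model of `P^I` with the special atoms
removed. -/
def IsStableModel {α : Type*} (P : BasicProgram α) (I : Set α) : Prop :=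
  ∃ M : Set (ExtAtom α), Minimal (PositiveRule.IsModel (P.reduct I)) M ∧
    I = {a | ExtAtom.ord a ∈ M}

end BasicProgram

/-- The sign of an edge of the dependency graph. -/
inductive EdgeSign where
  | pos
  | neg
  deriving DecidableEq

namespace BasicProgram

/-- The signed edges of the dependency graph of `P`. There is a positive edge from `u` to `v` if
`P` has a rule with head `u` and a c-atom `A` in its body with `v ∈ W` for some `W ⊎ V ∈ A_c^*`; there
is a negative edge if instead `v ∈ A_d \ (W ∪ V)`. -/
def DepEdge {α : Type*} (P : BasicProgram α) : EdgeSign → α → α → Prop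
  | EdgeSign.pos, u, v => ∃ r ∈ P, r.head = u ∧ ∃ A ∈ r.body, ∃ p ∈ A.absRep, v ∈ p.pre
  | EdgeSign.neg, u, v => ∃ r ∈ P, r.head = u ∧ ∃ A ∈ r.body, ∃ p ∈ A.absRep,
      v ∈ (A.dom : Set α) \ (p.pre ∪ p.free)

/-- A cycle of the dependency graph: a path
`vert 0 → vert 1 → ⋯ → vert len → vert 0` through distinct atoms, with a chosen signed edge at each
step (`i + 1` is taken modulo `len + 1`; `len = 0` is a self-loop). -/
structure DepCycle {α : Type*} (P : BasicProgram α) where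
  len : ℕ
  vert : Fin (len + 1) → α
  sign : Fin (len + 1) → EdgeSign
  injective : Function.Injective vert
  edge : ∀ i, P.DepEdge (sign i) (vert i) (vert (i + 1))

/-- The number of negative edges of a cycle. -/
def DepCycle.negCount {α : Type*} {P : BasicProgram α} (c : P.DepCycle) : ℕ :=
  (Finset.univ.filter (fun i => c.sign i = EdgeSign.neg)).card

/-- A cycle with only positive edges. -/
def HasPositiveCycle {α : Type*} (P : BasicProgram α) : Prop :=
  ∃ c : P.DepCycle, ∀ i, c.sign i = EdgeSign.pos

/-- A cycle with an odd number of negative edges. -/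
def HasOddCycle {α : Type*} (P : BasicProgram α) : Prop :=
  ∃ c : P.DepCycle, Odd c.negCount

/-- A cycle with an even number of negative edges. -/
def HasEvenCycle {α : Type*} (P : BasicProgram α) : Prop :=
  ∃ c : P.DepCycle, Even c.negCount

/-- `P` is call-consistent if it has no odd cycle. -/
def CallConsistent {α : Type*} (P : BasicProgram α) : Prop :=
  ¬ P.HasOddCycle

/-- `P` is acyclic if it has no cycle of any kind. -/
def Acyclic {α : Type*} (P : BasicProgram α) : Prop :=
  IsEmpty P.DepCycle

end BasicProgram

/-!
Replacing every c-atom `A` of a rule body by one of the members `W ⊎ V` of `A_c^*`, read as the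
conjunction of the atoms of `W` and of the negations of the atoms of `A_d \ (W ∪ V)`, turns a basic
program into a normal logic program with the same dependency graph: by `CAtom.sat_iff_exists_covers`
the c-atom `A` is the disjunction of these conjunctions. `P.consequences X` is the Gelfond-Lifschitz
operator of that normal program: the least set closed under the rules whose negative part avoids
`X`. A fixed point of this antitone operator is a stable model (`isStableModel_of_fixedPoint`), and
a stable model is a supported model (`IsStableModel.isSupportedModel`).

*More than one stable model.* If `I ≠ J` are supported models, then from every atom `u` on which
they differ there is an edge to another such atom `v`, positive if `u` and `v` lie in the same one
of `I` and `J` and negative otherwise. As there are finitely many such atoms, these edges contain a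
cycle, along which membership in `I` changes exactly at the negative edges; hence it is even.

*No positive cycle.* If `I` is a supported model, every atom of `I \ P.consequences I` has a
positive edge to another such atom, so this finite set is empty and `I` is a fixed point.

*Call-consistent programs.* A fixed point is built along the strongly connected components of the
dependency graph. Let `I` be a fixed point relative to a set `S` of atoms closed under dependencies,
and let `C` be a strongly connected component outside `S` all of whose edges stay in `S ∪ C`.
Without odd cycles, the parity of the walks from a fixed atom of `C` splits `C` into two classes,
such that positive edges in `C` stay in a class and negative edges change it. So each class of the
consequences of `I ∪ X` depends only on the other class of `X`, in an antitone way. The composition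
of the two resulting maps is monotone, and its least fixed point extends `I` to `S ∪ C`
(`exists_fixedPoint_of_relative`).

Simple cycles come from closed walks by induction on the length (`SignedWalk.exists_cycle`): a
closed walk which repeats a vertex splits into two shorter ones, and one of them is odd if the
walk is.
-/

/-! ### Walks and cycles in signed graphs -/

/-- `SignedWalk E n k u v`: the signed graph `E` has a walk from `u` to `v` with `n` edges, of which
`k` are negative. -/
inductive SignedWalk {α : Type*} (E : EdgeSign → α → α → Prop) : ℕ → ℕ → α → α → Prop
  | nil (u : α) : SignedWalk E 0 0 u u
  | cons {s : EdgeSign} {n k : ℕ} {u v w : α} (h : E s u v) (p : SignedWalk E n k v w) :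
      SignedWalk E (n + 1) (k + if s = EdgeSign.neg then 1 else 0) u w

namespace SignedWalk

variable {α : Type*} {E : EdgeSign → α → α → Prop}

theorem append {n k m l : ℕ} {u v w : α} (p : SignedWalk E n k u v) (q : SignedWalk E m l v w) :
    SignedWalk E (n + m) (k + l) u w := by
  induction p with
  | nil u => simpa using q
  | cons h p ih =>
    have := cons h (ih q)
    convert this using 1 <;> omega

theorem single {s : EdgeSign} {u v : α} (h : E s u v) :
    SignedWalk E 1 (if s = EdgeSign.neg then 1 else 0) u v := by
  simpa using cons h (nil v)

theorem of_seq {f : ℕ → α} {s : ℕ → EdgeSign} {i j : ℕ} (hij : i ≤ j)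
    (h : ∀ l, i ≤ l → l < j → E (s l) (f l) (f (l + 1))) :
    SignedWalk E (j - i) (∑ l ∈ Finset.Ico i j, if s l = EdgeSign.neg then 1 else 0)
      (f i) (f j) := by
  induction j, hij using Nat.le_induction with
  | base => simpa using nil (f i)
  | succ j hij ih =>
    have := (ih fun l h1 h2 => h l h1 (by omega)).append (single (h j hij (by omega)))
    rw [Finset.sum_Ico_succ_top hij, Nat.succ_sub hij]
    exact this

theorem exists_seq {n k : ℕ} {u v : α} (p : SignedWalk E n k u v) :
    ∃ (f : ℕ → α) (s : ℕ → EdgeSign), f 0 = u ∧ f n = v ∧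
      (∀ i < n, E (s i) (f i) (f (i + 1))) ∧
      k = ∑ i ∈ Finset.range n, if s i = EdgeSign.neg then 1 else 0 := by
  induction p with
  | nil u => exact ⟨fun _ => u, fun _ => EdgeSign.pos, rfl, rfl, by simp, by simp⟩
  | @cons s n k u v w h p ih =>
    obtain ⟨f, t, h0, hn, he, hk⟩ := ih
    refine ⟨fun i => Nat.casesOn i u f, fun i => Nat.casesOn i s t, rfl, hn, ?_, ?_⟩
    · rintro (_ | i) hi
      · simpa [h0] using h
      · exact he i (by omega)
    · rw [Finset.sum_range_succ', hk]
      rfl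

/-- A closed walk contains a simple cycle, and an odd closed walk contains an odd simple cycle: take
`Q` to be trivial or to be `Odd`. -/
theorem exists_cycle {Q : ℕ → Prop} (hQ : ∀ a b, Q (a + b) → Q a ∨ Q b) {n k : ℕ} {u : α}
    (hn : 0 < n) (p : SignedWalk E n k u u) (hk : Q k) :
    ∃ (m : ℕ) (vert : Fin (m + 1) → α) (sign : Fin (m + 1) → EdgeSign),
      Function.Injective vert ∧ (∀ i, E (sign i) (vert i) (vert (i + 1))) ∧
      Q (Finset.univ.filter fun i => sign i = EdgeSign.neg).card ∧
      ∃ l, SignedWalk E l (Finset.univ.filter fun i => sign i = EdgeSign.neg).card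
        (vert 0) (vert 0) := by
  induction n using Nat.strong_induction_on generalizing k u with
  | _ n ih =>
  obtain ⟨f, s, h0, hn', he, hsum⟩ := p.exists_seq
  by_cases hinj : ∃ i j, i < j ∧ j < n ∧ f i = f j
  · -- A repeated vertex splits the closed walk into two shorter ones.
    obtain ⟨i, j, hij, hjn, hf⟩ := hinj
    have p1 := of_seq (E := E) (s := s) hij.le fun l _ _ => he l (by omega)
    have p2 := (of_seq (E := E) (s := s) i.zero_le fun l _ _ => he l (by omega)).append
      (hf ▸ of_seq (E := E) (s := s) hjn.le fun l _ _ => he l (by omega))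
    rw [← hf] at p1
    rw [h0, hn'] at p2
    rw [Finset.range_eq_Ico, ← Finset.sum_Ico_consecutive _ i.zero_le (hij.le.trans hjn.le),
      ← Finset.sum_Ico_consecutive _ hij.le hjn.le, add_left_comm] at hsum
    rcases hQ _ _ (hsum ▸ hk) with h | h
    · exact ih _ (by omega) (by omega) p1 h
    · exact ih _ (by omega) (by omega) p2 h
  · push Not at hinj
    obtain ⟨m, rfl⟩ : ∃ m, n = m + 1 := ⟨n - 1, by omega⟩
    have hcard : (Finset.univ.filter fun i : Fin (m + 1) => s i = EdgeSign.neg).card = k := by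
      rw [hsum, Finset.card_filter,
        Fin.sum_univ_eq_sum_range (fun i => if s i = EdgeSign.neg then 1 else 0)]
    refine ⟨m, fun i => f i, fun i => s i, ?_, ?_, ?_, m + 1, ?_⟩
    · intro i j hij
      by_contra hne
      rcases lt_or_gt_of_ne (fun h => hne (Fin.ext h) : (i : ℕ) ≠ j) with h | h
      · exact hinj i j h j.2 hij
      · exact hinj j i h i.2 hij.symm
    · intro i
      have := he i i.2
      change E (s i) (f i) (f (i + 1 : Fin (m + 1)))
      rw [Fin.val_add_one]
      split_ifs with hi
      · subst hi
        simpa [h0, hn'] using this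
      · exact this
    · rwa [hcard]
    · rw [hcard]
      simpa [h0] using p

/-- A finite nonempty set in which every vertex has an outgoing edge contains a closed walk. -/
theorem exists_closed {D : Set α} (hfin : D.Finite) (hne : D.Nonempty)
    (h : ∀ u ∈ D, ∃ s, ∃ v ∈ D, E s u v) :
    ∃ n k u, 0 < n ∧ SignedWalk E n k u u := by
  have : Nonempty EdgeSign := ⟨EdgeSign.pos⟩
  choose! s g hg hE using h
  obtain ⟨x, hx⟩ := hne
  have hmem : ∀ i, g^[i] x ∈ D := fun i => by
    induction i with
    | zero => exact hx
    | succ i ih => rw [Function.iterate_succ_apply']; exact hg _ ih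
  obtain ⟨i, -, j, -, hij, hf⟩ :=
    Set.infinite_univ.exists_lt_map_eq_of_mapsTo (f := fun i => g^[i] x) (fun i _ => hmem i) hfin
  have := of_seq (E := E) (f := fun i => g^[i] x) (s := fun i => s (g^[i] x)) hij.le
    fun l _ _ => by
      simp only [Function.iterate_succ_apply']
      exact hE _ (hmem l)
  simp only [← hf] at this
  exact ⟨j - i, _, g^[i] x, by omega, this⟩

end SignedWalk

/-! ### The abstract representation of a c-atom -/

namespace CAtom

variable {α : Type*}

/-- The abstract representation of a c-atom represents its solutions. -/
theorem sat_iff_exists_covers (A : CAtom α) (I : Set α) :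
    A.Sat I ↔ ∃ p ∈ A.absRep, p.Covers (I ∩ A.dom) := by
  constructor
  · intro hS
    -- Among all prefixed power sets of solutions covering `I ∩ A_d`, one with a largest free part
    -- is both maximal and irredundant.
    let T : Set (PrefixedPowerSet α) := {q | q.pre ∈ A.sols ∧ q.free ⊆ (A.dom : Set α) \ q.pre ∧
      (∀ S : Set α, q.Covers S → S ∈ A.sols) ∧ q.Covers (I ∩ A.dom)}
    have hTne : T.Nonempty := by
      refine ⟨⟨I ∩ A.dom, ∅⟩, hS, Set.empty_subset _, ?_, subset_rfl, by simp⟩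
      rintro S ⟨h1, h2⟩
      have : S = I ∩ A.dom := Set.Subset.antisymm (by simpa using h2) h1
      rw [this]
      exact hS
    have hfin : (PrefixedPowerSet.free '' T).Finite := by
      refine A.dom.finite_toSet.finite_subsets.subset ?_
      rintro _ ⟨q, hq, rfl⟩
      exact hq.2.1.trans Set.sdiff_subset
    obtain ⟨_, ⟨⟨q, hq, rfl⟩, hmax⟩⟩ := hfin.exists_maximal (hTne.image _)
    obtain ⟨hq1, hq2, hq3, hq4⟩ := hq
    refine ⟨q, ⟨⟨hq1, hq2, hq3, ?_⟩, ?_⟩, hq4⟩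
    · rintro ⟨V', hV, hV', hsol⟩
      refine hV.2 (hmax ⟨⟨q.pre, V'⟩, ⟨hq1, hV', hsol, hq4.1, hq4.2.trans ?_⟩, rfl⟩ hV.1)
      exact Set.union_subset_union_right _ hV.1
    · rintro ⟨q', hq', hne, hincl⟩
      have hlow : q'.pre ⊆ q.pre := (hincl q.pre ⟨subset_rfl, Set.subset_union_left⟩).1
      have hupp : q.pre ∪ q.free ⊆ q'.pre ∪ q'.free :=
        (hincl _ ⟨Set.subset_union_left, subset_rfl⟩).2
      have hfree : q.free ⊆ q'.free := fun v hv =>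
        (hupp (Or.inr hv)).resolve_left fun h => (hq2 hv).2 (hlow h)
      have hfree' : q'.free ⊆ q.free :=
        hmax ⟨q', ⟨hq'.1, hq'.2.1, hq'.2.2.1, hincl _ hq4⟩, rfl⟩ hfree
      have hpre : q.pre ⊆ q'.pre := fun v hv =>
        (hupp (Or.inl hv)).resolve_right fun h => (hq2 (hfree' h)).2 hv
      exact hne (PrefixedPowerSet.ext (hlow.antisymm hpre) (hfree'.antisymm hfree))
  · rintro ⟨p, hp, hc⟩
    exact hp.1.2.2.1 _ hc

/-- Covering `I ∩ A_d` means satisfying the conjunction that `W ⊎ V` stands for. -/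
theorem covers_inter_iff {A : CAtom α} {p : PrefixedPowerSet α} (hp : p ∈ A.absRep) {I : Set α} :
    p.Covers (I ∩ A.dom) ↔
      p.pre ⊆ I ∧ ∀ v ∈ (A.dom : Set α) \ (p.pre ∪ p.free), v ∉ I := by
  constructor
  · rintro ⟨h1, h2⟩
    exact ⟨h1.trans Set.inter_subset_left, fun v hv hI => hv.2 (h2 ⟨hI, hv.1⟩)⟩
  · rintro ⟨h1, h2⟩
    refine ⟨Set.subset_inter h1 (A.sols_subset _ hp.1.1), fun v hv => ?_⟩
    by_contra h
    exact h2 v ⟨hv.2, h⟩ hv.1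

end CAtom

/-! ### The Gelfond-Lifschitz operator -/

namespace BasicProgram

variable {α : Type*} {P : BasicProgram α}

/-- The least set of atoms closed under those normal rules of `P` whose negative part avoids `X`. A
normal rule of `P` is given by a rule `r` of `P` and a choice, for every c-atom `A` in the body of
`r`, of a member `p A` of `A_c^*`. -/
inductive consequences (P : BasicProgram α) (X : Set α) : Set α
  | intro (r : BasicRule α) (hr : r ∈ P) (p : CAtom α → PrefixedPowerSet α)
      (hp : ∀ A ∈ r.body, p A ∈ A.absRep)
      (hneg : ∀ A ∈ r.body, ∀ v ∈ (A.dom : Set α) \ ((p A).pre ∪ (p A).free), v ∉ X)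
      (hpos : ∀ A ∈ r.body, ∀ v ∈ (p A).pre, consequences P X v) : consequences P X r.head

/-- Consequences within a set `T` closed under positive dependencies can only be lost by enlarging
the set on which the negative dependencies of `T` are tested. -/
theorem consequences_inter_subset {T X Y : Set α}
    (hT : ∀ u ∈ T, ∀ v, P.DepEdge EdgeSign.pos u v → v ∈ T)
    (hXY : ∀ u ∈ T, ∀ v, P.DepEdge EdgeSign.neg u v → v ∈ Y → v ∈ X) :
    P.consequences X ∩ T ⊆ P.consequences Y := by
  rintro a ⟨ha, haT⟩
  induction ha with
  | intro r hr p hp hneg hpos ih =>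
    refine consequences.intro r hr p hp (fun A hA v hv hY => ?_) fun A hA v hv => ?_
    · exact hneg A hA v hv (hXY _ haT v ⟨r, hr, rfl, A, hA, p A, hp A hA, hv⟩ hY)
    · exact ih A hA v hv (hT _ haT v ⟨r, hr, rfl, A, hA, p A, hp A hA, hv⟩)

theorem consequences_antitone : Antitone P.consequences := fun _ _ hXY _ ha =>
  consequences_inter_subset (T := Set.univ) (fun _ _ _ _ => trivial) (fun _ _ _ _ h => hXY h)
    ⟨ha, trivial⟩

theorem exists_rule_of_mem_consequences {X : Set α} {a : α} (h : a ∈ P.consequences X) :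
    ∃ r ∈ P, r.head = a := by
  cases h with
  | intro r hr => exact ⟨r, hr, rfl⟩

theorem finite_of_forall_head {D : Set α} (h : ∀ a ∈ D, ∃ r ∈ P, r.head = a) : D.Finite :=
  (P.finite_toSet.image BasicRule.head).subset fun a ha => by
    obtain ⟨r, hr, rfl⟩ := h a ha
    exact ⟨r, hr, rfl⟩

/-- If `I` satisfies the body of `r` then the head of `r` is a consequence, provided that those
positive dependencies of it which lie in `I` are. -/
theorem mem_consequences_of_bodySat {I Y : Set α} {r : BasicRule α} (hr : r ∈ P)
    (hb : r.BodySat I) (hY : ∀ v, P.DepEdge EdgeSign.pos r.head v → v ∈ I → v ∈ Y)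
    (hYI : Y ⊆ P.consequences I) : r.head ∈ P.consequences I := by
  have : ∀ A, ∃ p : PrefixedPowerSet α, A ∈ r.body → p ∈ A.absRep ∧ p.Covers (I ∩ A.dom) := by
    intro A
    by_cases hA : A ∈ r.body
    · obtain ⟨p, hp⟩ := (A.sat_iff_exists_covers I).1 (hb A hA)
      exact ⟨p, fun _ => hp⟩
    · exact ⟨⟨∅, ∅⟩, fun h => absurd h hA⟩
  choose p hp using this
  have hcov := fun A hA => (CAtom.covers_inter_iff (hp A hA).1).1 (hp A hA).2
  exact consequences.intro r hr p (fun A hA => (hp A hA).1) (fun A hA => (hcov A hA).2)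
    fun A hA v hv => hYI (hY v ⟨r, hr, rfl, A, hA, p A, (hp A hA).1, hv⟩ ((hcov A hA).1 hv))

theorem IsModel.consequences_subset {I : Set α} (hI : P.IsModel I) : P.consequences I ⊆ I := by
  intro a ha
  induction ha with
  | intro r hr p hp hneg hpos ih =>
    exact hI r hr fun A hA => (A.sat_iff_exists_covers I).2
      ⟨p A, hp A hA, (CAtom.covers_inter_iff (hp A hA)).2 ⟨ih A hA, hneg A hA⟩⟩

theorem isStableModel_of_fixedPoint {I : Set α} (hI : P.consequences I = I) :
    P.IsStableModel I := by
  have hmodel : P.IsModel I := fun r hr hb => by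
    rw [← hI]
    exact mem_consequences_of_bodySat (Y := I) hr hb (fun _ _ h => h) hI.ge
  let M : Set (ExtAtom α) := ExtAtom.ord '' I ∪
    {x | ∃ r ∈ P, r.BodySat I ∧ ∃ A ∈ r.body, x = ExtAtom.theta A}
  have hord : ∀ a, ExtAtom.ord a ∈ M ↔ a ∈ I := by
    intro a
    simp [M]
  refine ⟨M, ⟨?_, ?_⟩, by simp [hord]⟩
  · rintro _ ⟨r, hr, hb, rfl | ⟨A, hA, W, hW, rfl⟩⟩ -
    · exact (hord _).2 (hmodel r hr hb)
    · exact Or.inr ⟨r, hr, hb, A, hA, rfl⟩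
  · intro M' hM' hle
    have htheta : ∀ r ∈ P, r.BodySat I → ∀ A ∈ r.body, ∀ p ∈ A.absRep, p.Covers (I ∩ A.dom) →
        (∀ v ∈ p.pre, ExtAtom.ord v ∈ M') → ExtAtom.theta A ∈ M' := by
      intro r hr hb A hA p hp hc hpre
      refine hM' ⟨ExtAtom.theta A, ExtAtom.ord '' p.pre⟩
        ⟨r, hr, hb, Or.inr ⟨A, hA, p.pre, ⟨p, hp, hc, rfl⟩, rfl⟩⟩ ?_
      rintro _ ⟨v, hv, rfl⟩
      exact hpre v hv
    have hsub : ∀ a ∈ P.consequences I, ExtAtom.ord a ∈ M' := by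
      intro a ha
      induction ha with
      | intro r hr p hp hneg hpos ih =>
        have hc : ∀ A ∈ r.body, (p A).Covers (I ∩ A.dom) := fun A hA =>
          (CAtom.covers_inter_iff (hp A hA)).2
            ⟨fun v hv => (hord v).1 (hle (ih A hA v hv)), hneg A hA⟩
        have hb : r.BodySat I := fun A hA =>
          (A.sat_iff_exists_covers I).2 ⟨p A, hp A hA, hc A hA⟩
        refine hM' ⟨ExtAtom.ord r.head, {x | ∃ A ∈ r.body, x = ExtAtom.theta A}⟩
          ⟨r, hr, hb, Or.inl rfl⟩ ?_
        rintro _ ⟨A, hA, rfl⟩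
        exact htheta r hr hb A hA (p A) (hp A hA) (hc A hA) (ih A hA)
    rw [hI] at hsub
    rintro _ (⟨a, ha, rfl⟩ | ⟨r, hr, hb, A, hA, rfl⟩)
    · exact hsub a ha
    · obtain ⟨p, hp, hc⟩ := (A.sat_iff_exists_covers I).1 (hb A hA)
      exact htheta r hr hb A hA p hp hc fun v hv => hsub v (hc.1 hv).1

theorem IsStableModel.isSupportedModel {I : Set α} (h : P.IsStableModel I) :
    P.IsSupportedModel I := by
  obtain ⟨M, hM, rfl⟩ := h
  set I : Set α := {a | ExtAtom.ord a ∈ M} with hI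
  refine ⟨fun r hr hb => ?_, fun a ha => ?_⟩
  · refine hM.prop ⟨ExtAtom.ord r.head, {x | ∃ A ∈ r.body, x = ExtAtom.theta A}⟩
      ⟨r, hr, hb, Or.inl rfl⟩ ?_
    rintro _ ⟨A, hA, rfl⟩
    obtain ⟨p, hp, hc⟩ := (A.sat_iff_exists_covers I).1 (hb A hA)
    refine hM.prop ⟨ExtAtom.theta A, ExtAtom.ord '' p.pre⟩
      ⟨r, hr, hb, Or.inr ⟨A, hA, p.pre, ⟨p, hp, hc, rfl⟩, rfl⟩⟩ ?_
    rintro _ ⟨v, hv, rfl⟩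
    exact (hc.1 hv).1
  · -- An unsupported atom could be deleted from the minimal model.
    by_contra hno
    have hmod : PositiveRule.IsModel (P.reduct I) (M \ {ExtAtom.ord a}) := by
      intro q hq hbody
      refine ⟨hM.prop q hq (hbody.trans Set.sdiff_subset), ?_⟩
      obtain ⟨r, hr, hb, rfl | ⟨A, hA, W, hW, rfl⟩⟩ := hq
      · intro heq
        exact hno ⟨r, hr, ExtAtom.ord.inj heq, hb⟩
      · intro heq
        cases heq
    exact (hM.le_of_le hmod Set.sdiff_subset ha).2 rfl

/-! ### Several stable models, and programs without positive cycles -/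

theorem hasEvenCycle_of_ne {I J : Set α} (hI : P.IsSupportedModel I) (hJ : P.IsSupportedModel J)
    (hne : I ≠ J) : P.HasEvenCycle := by
  -- The edges between atoms on which `I` and `J` differ, with the sign given by membership in `I`.
  let E : EdgeSign → α → α → Prop := fun s u v =>
    P.DepEdge s u v ∧ (s = EdgeSign.pos ↔ (u ∈ I ↔ v ∈ I))
  have step : ∀ {I J : Set α}, P.IsSupportedModel I → P.IsSupportedModel J → ∀ u ∈ I, u ∉ J →
      (∃ v ∈ I, v ∉ J ∧ P.DepEdge EdgeSign.pos u v) ∨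
        ∃ v ∈ J, v ∉ I ∧ P.DepEdge EdgeSign.neg u v := by
    intro I J hI hJ u hu hu'
    obtain ⟨r, hr, rfl, hb⟩ := hI.2 u hu
    have : ¬ r.BodySat J := fun h => hu' (hJ.1 r hr h)
    unfold BasicRule.BodySat at this
    push Not at this
    obtain ⟨A, hA, hAJ⟩ := this
    obtain ⟨p, hp, hc⟩ := (A.sat_iff_exists_covers I).1 (hb A hA)
    rw [CAtom.covers_inter_iff hp] at hc
    by_cases hpre : p.pre ⊆ J
    · have : ¬ ∀ v ∈ (A.dom : Set α) \ (p.pre ∪ p.free), v ∉ J := fun h =>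
        hAJ ((A.sat_iff_exists_covers J).2 ⟨p, hp, (CAtom.covers_inter_iff hp).2 ⟨hpre, h⟩⟩)
      push Not at this
      obtain ⟨v, hv, hvJ⟩ := this
      exact Or.inr ⟨v, hvJ, hc.2 v hv, r, hr, rfl, A, hA, p, hp, hv⟩
    · obtain ⟨v, hv, hvJ⟩ := Set.not_subset.1 hpre
      exact Or.inl ⟨v, hc.1 hv, hvJ, r, hr, rfl, A, hA, p, hp, hv⟩
  have hfin : (symmDiff I J).Finite := finite_of_forall_head (P := P) fun a ha => by
    rcases ha with ha | ha
    · obtain ⟨r, hr, h, -⟩ := hI.2 a ha.1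
      exact ⟨r, hr, h⟩
    · obtain ⟨r, hr, h, -⟩ := hJ.2 a ha.1
      exact ⟨r, hr, h⟩
  obtain ⟨n, k, u, hn, hw⟩ := SignedWalk.exists_closed (E := E) hfin
    (Set.nonempty_iff_ne_empty.2 fun h => hne (symmDiff_eq_bot.1 h)) (by
      rintro u (⟨hu, hu'⟩ | ⟨hu, hu'⟩)
      · rcases step hI hJ u hu hu' with ⟨v, hv, hv', he⟩ | ⟨v, hv, hv', he⟩
        · exact ⟨_, v, Or.inl ⟨hv, hv'⟩, he, by simp [hu, hv]⟩
        · exact ⟨_, v, Or.inr ⟨hv, hv'⟩, he, by simp [hu, hv']⟩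
      · rcases step hJ hI u hu hu' with ⟨v, hv, hv', he⟩ | ⟨v, hv, hv', he⟩
        · exact ⟨_, v, Or.inr ⟨hv, hv'⟩, he, by simp [hu', hv']⟩
        · exact ⟨_, v, Or.inl ⟨hv, hv'⟩, he, by simp [hu', hv]⟩)
  have hpar : ∀ {n k : ℕ} {u v : α}, SignedWalk E n k u v → (Even k ↔ (u ∈ I ↔ v ∈ I)) := by
    intro n k u v hw
    induction hw with
    | nil u => simp
    | @cons s n k u v w h p ih =>
      have := h.2
      cases s
      · simp only [reduceCtorEq, if_false, add_zero]
        tauto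
      · simp only [reduceCtorEq, if_true, Nat.even_add_one] at this ⊢
        tauto
  obtain ⟨m, vert, sign, hinj, he, -, l, hl⟩ :=
    hw.exists_cycle (Q := fun _ => True) (fun _ _ _ => Or.inl trivial) hn trivial
  exact ⟨⟨m, vert, sign, hinj, fun i => (he i).1⟩, (hpar hl).2 Iff.rfl⟩

theorem IsSupportedModel.consequences_eq (hP : ¬ P.HasPositiveCycle) {I : Set α}
    (hI : P.IsSupportedModel I) : P.consequences I = I := by
  refine hI.1.consequences_subset.antisymm ?_
  by_contra hsub
  let E : EdgeSign → α → α → Prop := fun s u v => s = EdgeSign.pos ∧ P.DepEdge s u v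
  have hfin : (I \ P.consequences I).Finite := finite_of_forall_head (P := P) fun a ha => by
    obtain ⟨r, hr, h, -⟩ := hI.2 a ha.1
    exact ⟨r, hr, h⟩
  obtain ⟨n, k, u, hn, hw⟩ := SignedWalk.exists_closed (E := E) hfin
    (Set.sdiff_nonempty.2 hsub) (by
      rintro u ⟨hu, hu'⟩
      obtain ⟨r, hr, rfl, hb⟩ := hI.2 u hu
      by_contra hno
      refine hu' (mem_consequences_of_bodySat (Y := P.consequences I) hr hb ?_ subset_rfl)
      intro v he hv
      by_contra hv'
      exact hno ⟨_, v, ⟨hv, hv'⟩, rfl, he⟩)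
  obtain ⟨m, vert, sign, hinj, he, -⟩ :=
    hw.exists_cycle (Q := fun _ => True) (fun _ _ _ => Or.inl trivial) hn trivial
  exact hP ⟨⟨m, vert, sign, hinj, fun i => (he i).2⟩, fun i => (he i).1⟩

/-! ### Call-consistent programs -/

theorem CallConsistent.not_odd (hP : P.CallConsistent) {n k : ℕ} {u : α}
    (p : SignedWalk P.DepEdge n k u u) : ¬ Odd k := by
  intro hk
  have hn : 0 < n := by
    cases p with
    | nil => simp at hk
    | cons => omega
  obtain ⟨m, vert, sign, hinj, he, hodd, -⟩ := p.exists_cycle (Q := Odd)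
    (fun a b h => by
      rw [Nat.odd_add] at h
      by_cases ha : Odd a
      · exact Or.inl ha
      · exact Or.inr (Nat.not_even_iff_odd.1 fun hb => ha (h.2 hb))) hn hk
  exact hP ⟨⟨m, vert, sign, hinj, he⟩, hodd⟩

/-- Extension of a fixed point relative to `S` by two parity classes `C₀` and `C₁`. -/
theorem exists_relative_fixedPoint {S C₀ C₁ I : Set α}
    (hS : ∀ u ∈ S, ∀ s v, P.DepEdge s u v → v ∈ S)
    (hpos₀ : ∀ u ∈ C₀, ∀ v, P.DepEdge EdgeSign.pos u v → v ∈ S ∪ C₀)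
    (hneg₀ : ∀ u ∈ C₀, ∀ v, P.DepEdge EdgeSign.neg u v → v ∈ S ∪ C₁)
    (hpos₁ : ∀ u ∈ C₁, ∀ v, P.DepEdge EdgeSign.pos u v → v ∈ S ∪ C₁)
    (hneg₁ : ∀ u ∈ C₁, ∀ v, P.DepEdge EdgeSign.neg u v → v ∈ S ∪ C₀)
    (hS₀ : Disjoint S C₀) (hS₁ : Disjoint S C₁) (h₀₁ : Disjoint C₀ C₁)
    (hIS : I ⊆ S) (hI : P.consequences I ∩ S = I) :
    ∃ J ⊆ S ∪ (C₀ ∪ C₁), P.consequences J ∩ (S ∪ (C₀ ∪ C₁)) = J := by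
  let h : Set α →o Set α :=
    ⟨fun X => P.consequences (I ∪ P.consequences (I ∪ X) ∩ C₁) ∩ C₀, fun X Y hXY =>
      Set.inter_subset_inter_left _ (consequences_antitone (Set.union_subset_union_right _
        (Set.inter_subset_inter_left _ (consequences_antitone
          (Set.union_subset_union_right _ hXY)))))⟩
  set X₀ := h.lfp with hX₀
  set X₁ := P.consequences (I ∪ X₀) ∩ C₁ with hX₁
  have hfix : P.consequences (I ∪ X₁) ∩ C₀ = X₀ := h.map_lfp
  have hX₀C : X₀ ⊆ C₀ := hfix ▸ Set.inter_subset_right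
  have hX₁C : X₁ ⊆ C₁ := Set.inter_subset_right
  rw [Set.disjoint_left] at hS₀ hS₁ h₀₁
  set J := I ∪ (X₀ ∪ X₁) with hJ
  have hJS : P.consequences J ∩ S = I := by
    refine Set.Subset.antisymm (fun a ha => ?_) fun a ha => ?_
    · rw [← hI]
      exact ⟨consequences_antitone (Set.subset_union_left) ha.1, ha.2⟩
    · refine ⟨consequences_inter_subset (X := I) (fun u hu v => hS u hu _ v)
        (fun u hu v he hv => ?_) (hI.ge ha), hIS ha⟩
      have hvS := hS u hu _ v he
      rcases hv with hv | hv | hv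
      · exact hv
      · exact absurd (hX₀C hv) (hS₀ hvS)
      · exact absurd (hX₁C hv) (hS₁ hvS)
  have hJ₀ : P.consequences J ∩ C₀ = X₀ := by
    rw [← hfix]
    refine Set.Subset.antisymm (fun a ha => ⟨consequences_antitone ?_ ha.1, ha.2⟩)
      fun a ha => ⟨consequences_inter_subset (X := I ∪ X₁) (T := S ∪ C₀) ?_ ?_
        ⟨ha.1, Or.inr ha.2⟩, ha.2⟩
    · exact Set.union_subset_union_right _ Set.subset_union_right
    · rintro u (hu | hu) v he
      · exact Or.inl (hS u hu _ v he)
      · exact hpos₀ u hu v he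
    · rintro u hu v he hv
      have hv' : v ∈ S ∪ C₁ := hu.elim (fun hu => Or.inl (hS u hu _ v he)) (hneg₀ u · v he)
      rcases hv with hv | hv | hv
      · exact Or.inl hv
      · exact absurd (hX₀C hv) fun h => hv'.elim (hS₀ · h) (h₀₁ h)
      · exact Or.inr hv
  have hJ₁ : P.consequences J ∩ C₁ = X₁ := by
    rw [hX₁]
    refine Set.Subset.antisymm (fun a ha => ⟨consequences_antitone ?_ ha.1, ha.2⟩)
      fun a ha => ⟨consequences_inter_subset (X := I ∪ X₀) (T := S ∪ C₁) ?_ ?_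
        ⟨ha.1, Or.inr ha.2⟩, ha.2⟩
    · exact Set.union_subset_union_right _ Set.subset_union_left
    · rintro u (hu | hu) v he
      · exact Or.inl (hS u hu _ v he)
      · exact hpos₁ u hu v he
    · rintro u hu v he hv
      have hv' : v ∈ S ∪ C₀ := hu.elim (fun hu => Or.inl (hS u hu _ v he)) (hneg₁ u · v he)
      rcases hv with hv | hv | hv
      · exact Or.inl hv
      · exact Or.inr hv
      · exact absurd (hX₁C hv) fun h => hv'.elim (hS₁ · h) (h₀₁ · h)
  refine ⟨J, Set.union_subset_union hIS (Set.union_subset_union hX₀C hX₁C), ?_⟩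
  rw [Set.inter_union_distrib_left, Set.inter_union_distrib_left, hJS, hJ₀, hJ₁]

/-- A fixed point relative to a set `S` closed under dependencies leads to a fixed point, by adding
the remaining strongly connected components to `S` one at a time. -/
theorem CallConsistent.exists_fixedPoint_of_relative (hP : P.CallConsistent) {S I : Set α}
    (hfin : Sᶜ.Finite) (hS : ∀ u ∈ S, ∀ s v, P.DepEdge s u v → v ∈ S) (hIS : I ⊆ S)
    (hI : P.consequences I ∩ S = I) : ∃ J, P.consequences J = J := by
  induction hn : Sᶜ.ncard using Nat.strong_induction_on generalizing S I with
  | _ n ih =>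
  rcases Sᶜ.eq_empty_or_nonempty with hempty | hne
  · rw [Set.compl_empty_iff] at hempty
    exact ⟨I, by simpa [hempty] using hI⟩
  -- An atom outside `S` with a least set of reachable atoms generates a component all of whose
  -- outgoing edges lead into `S`.
  obtain ⟨u, huS, hmin⟩ := hfin.exists_minimalFor
    (fun u => {v | ∃ n k, SignedWalk P.DepEdge n k u v}) _ hne
  have hback : ∀ v ∉ S, (∃ n k, SignedWalk P.DepEdge n k u v) →
      ∃ n k, SignedWalk P.DepEdge n k v u := by
    rintro v hv ⟨n, k, p⟩
    refine hmin hv ?_ ⟨0, 0, SignedWalk.nil u⟩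
    rintro w ⟨m, l, q⟩
    exact ⟨_, _, p.append q⟩
  let C₀ : Set α := {v | v ∉ S ∧ ∃ n k, SignedWalk P.DepEdge n k u v ∧ Even k}
  let C₁ : Set α := {v | v ∉ S ∧ ∃ n k, SignedWalk P.DepEdge n k u v ∧ Odd k}
  have hdisj : Disjoint C₀ C₁ := by
    rw [Set.disjoint_left]
    rintro v ⟨hv, n, k, p, hk⟩ ⟨-, m, l, q, hl⟩
    obtain ⟨i, j, b⟩ := hback v hv ⟨n, k, p⟩
    rcases Nat.even_or_odd j with hj | hj
    · exact hP.not_odd (q.append b) (hl.add_even hj)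
    · exact hP.not_odd (p.append b) (hk.add_odd hj)
  have hpos₀ : ∀ a ∈ C₀, ∀ v, P.DepEdge EdgeSign.pos a v → v ∈ S ∪ C₀ := by
    rintro a ⟨-, n, k, p, hk⟩ v he
    by_cases hv : v ∈ S
    · exact Or.inl hv
    · exact Or.inr ⟨hv, _, _, p.append (.single he), by simpa using hk⟩
  have hneg₀ : ∀ a ∈ C₀, ∀ v, P.DepEdge EdgeSign.neg a v → v ∈ S ∪ C₁ := by
    rintro a ⟨-, n, k, p, hk⟩ v he
    by_cases hv : v ∈ S
    · exact Or.inl hv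
    · exact Or.inr ⟨hv, _, _, p.append (.single he), by simpa using hk.add_one⟩
  have hpos₁ : ∀ a ∈ C₁, ∀ v, P.DepEdge EdgeSign.pos a v → v ∈ S ∪ C₁ := by
    rintro a ⟨-, n, k, p, hk⟩ v he
    by_cases hv : v ∈ S
    · exact Or.inl hv
    · exact Or.inr ⟨hv, _, _, p.append (.single he), by simpa using hk⟩
  have hneg₁ : ∀ a ∈ C₁, ∀ v, P.DepEdge EdgeSign.neg a v → v ∈ S ∪ C₀ := by
    rintro a ⟨-, n, k, p, hk⟩ v he
    by_cases hv : v ∈ S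
    · exact Or.inl hv
    · exact Or.inr ⟨hv, _, _, p.append (.single he), by simpa using hk.add_one⟩
  obtain ⟨J, hJS, hJ⟩ := exists_relative_fixedPoint hS hpos₀ hneg₀ hpos₁ hneg₁
    (Set.disjoint_left.2 fun v hv h => h.1 hv) (Set.disjoint_left.2 fun v hv h => h.1 hv)
    hdisj hIS hI
  have hsub : (S ∪ (C₀ ∪ C₁))ᶜ ⊂ Sᶜ := by
    refine ⟨Set.compl_subset_compl.2 Set.subset_union_left, fun h => ?_⟩
    exact h huS (Or.inr (Or.inl ⟨huS, 0, 0, SignedWalk.nil u, Even.zero⟩))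
  refine ih _ (hn ▸ Set.ncard_lt_ncard hsub hfin) (hfin.subset hsub.1) ?_ hJS hJ rfl
  rintro a (ha | ha | ha) s v he
  · exact Or.inl (hS a ha s v he)
  · cases s
    · exact (hpos₀ a ha v he).imp_right Or.inl
    · exact (hneg₀ a ha v he).imp_right Or.inr
  · cases s
    · exact (hpos₁ a ha v he).imp_right Or.inr
    · exact (hneg₁ a ha v he).imp_right Or.inl

theorem CallConsistent.exists_isStableModel (hP : P.CallConsistent) :
    ∃ I, P.IsStableModel I := by
  -- Atoms that are not heads of rules have no outgoing edges and are never derived.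
  obtain ⟨J, hJ⟩ := hP.exists_fixedPoint_of_relative (S := {a | ¬ ∃ r ∈ P, r.head = a}) (I := ∅)
    (finite_of_forall_head (P := P) fun a ha => not_not.1 ha)
    (by
      rintro u hu (_ | _) v ⟨r, hr, h, -⟩
      · exact absurd ⟨r, hr, h⟩ hu
      · exact absurd ⟨r, hr, h⟩ hu)
    (Set.empty_subset _)
    (Set.eq_empty_of_forall_notMem fun a ha => ha.2 (exists_rule_of_mem_consequences ha.1))
  exact ⟨J, isStableModel_of_fixedPoint hJ⟩

end BasicProgram

theorem mainTheorem2 {α : Type*} (P : BasicProgram α) :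
    (P.CallConsistent → ∃ I : Set α, P.IsStableModel I) ∧
    ((∃ I J : Set α, P.IsStableModel I ∧ P.IsStableModel J ∧ I ≠ J) → P.HasEvenCycle) ∧
    (P.Acyclic → ∃! I : Set α, P.IsStableModel I) ∧
    (¬ P.HasPositiveCycle → ∀ I : Set α, P.IsSupportedModel I → P.IsStableModel I) := by
  have several : ∀ I J : Set α, P.IsStableModel I → P.IsStableModel J → I ≠ J → P.HasEvenCycle :=
    fun I J hI hJ => BasicProgram.hasEvenCycle_of_ne hI.isSupportedModel hJ.isSupportedModel
  refine ⟨fun h => h.exists_isStableModel, ?_, fun h => ?_, fun h I hI => ?_⟩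
  · rintro ⟨I, J, hI, hJ, hne⟩
    exact several I J hI hJ hne
  · have hcc : P.CallConsistent := fun ⟨c, _⟩ => h.false c
    obtain ⟨I, hI⟩ := hcc.exists_isStableModel
    refine ⟨I, hI, fun J hJ => ?_⟩
    by_contra hne
    obtain ⟨c, -⟩ := several J I hJ hI hne
    exact h.false c
  · exact BasicProgram.isStableModel_of_fixedPoint (hI.consequences_eq h)
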